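/- Let $G$ be a finite simple graph that is $2$-edge-connected (that is, $G$ is connected and remains connected after the deletion of any one edge), claw-free (that is, no induced subgraph of $G$ is isomorphic to $K_{1,3}$) and cubic (that is, every vertex has degree $3$). Then $G$ is $(1,1,2,2)$-colorable: there is a map $f : V(G) \to \{1,2,3,4\}$ such that, with $(a_1,a_2,a_3,a_4) = (1,1,2,2)$, any two distinct vertices $u,v$ with $f(u)=f(v)=i$ are at distance greater than $a_i$ in $G$. Equivalently, $V(G)$ can be partitioned into four (possibly empty) sets, two of which are independent and two of which consist of vertices at pairwise distance at least $3$. -/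

import Mathlib

namespace SimpleGraph

/-- A graph is claw-free if it has no induced subgraph isomorphic to the claw `K_{1,3}`. -/
def IsClawFree {V : Type*} (G : SimpleGraph V) : Prop :=
  ¬ (completeBipartiteGraph (Fin 1) (Fin 3)).IsIndContained G

/-- For a sequence `S = (S 0, …, S (r - 1))`, a map `f : V → Fin r` is an `S`-packing coloring
if any two distinct vertices of the same color `i` are at distance greater than `S i`.
The distance is extended: vertices in different components are at distance `⊤`. -/
def IsPackingColoring {V : Type*} (G : SimpleGraph V) {r : ℕ} (S : Fin r → ℕ)
    (f : V → Fin r) : Prop :=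
  ∀ i : Fin r, ∀ u v : V, u ≠ v → f u = i → f v = i → (S i : ℕ∞) < G.edist u v

/-- `G` is `S`-packing colorable. -/
def PackingColorable {V : Type*} (G : SimpleGraph V) {r : ℕ} (S : Fin r → ℕ) : Prop :=
  ∃ f : V → Fin r, G.IsPackingColoring S f

end SimpleGraph

/-! If some neighborhood is a triangle, connectedness forces at most four vertices, and an injective
coloring works. Otherwise every neighborhood induces one or two edges (`IsLocallyPath`), so the
vertices split into lone triangles and diamonds, and the edges in no triangle match the outer
vertices in pairs.

Two disjoint sets are built, each with pairwise distances at least 3, so that the remaining vertices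
induce a bipartite graph. In every lone triangle the vertex nearest to a root is selected. Its
pendant edge leads closer to the root, so the parity of the number of such descents gives triangles
colors that differ along these edges (`exists_selection`); selected vertices of equal color are then
far apart.

Each diamond adds one or two vertices, depending on which colors its ends see across their pendant
edges (`InPacking`, `inPacking_eq_of_near`). Among the vertices left over, set aside the diamond
ends next to selected vertices. On the rest, triangle edges and pendant edges each form a partial
matching, and a union of two matchings is bipartite. The ends set aside have at most one neighbor
there and are not adjacent to each other, so the 2-coloring extends (`exists_two_coloring`). -/

namespace SimpleGraph

/-! ### Local structure: lone triangles, diamonds and pendant edges. -/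

/-- An edge lying in a triangle. -/
def TriangleEdge {V : Type*} (G : SimpleGraph V) (u v : V) : Prop :=
  G.Adj u v ∧ ∃ w, G.Adj u w ∧ G.Adj v w

/-- An edge lying in no triangle. -/
def PendantEdge {V : Type*} (G : SimpleGraph V) (u v : V) : Prop :=
  G.Adj u v ∧ ¬ ∃ w, G.Adj u w ∧ G.Adj v w

/-- A vertex incident with an edge that lies in no triangle. -/
def IsOuter {V : Type*} (G : SimpleGraph V) (v : V) : Prop := ∃ w, G.PendantEdge v w

/-- Every neighborhood has three vertices and induces a graph with one or two edges. -/
def IsLocallyPath {V : Type*} (G : SimpleGraph V) : Prop :=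
  ∀ v, ∃ x y z, x ≠ y ∧ x ≠ z ∧ y ≠ z ∧ (∀ w, G.Adj v w ↔ w = x ∨ w = y ∨ w = z) ∧
    G.Adj x y ∧ ¬ G.Adj y z

variable {V : Type*} {G : SimpleGraph V} {u v w : V}

lemma TriangleEdge.symm (h : G.TriangleEdge u v) : G.TriangleEdge v u := by
  obtain ⟨h, w, hw⟩ := h; exact ⟨h.symm, w, hw.symm⟩

lemma PendantEdge.symm (h : G.PendantEdge u v) : G.PendantEdge v u := by
  obtain ⟨h, hw⟩ := h; exact ⟨h.symm, fun ⟨w, h⟩ ↦ hw ⟨w, h.symm⟩⟩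

lemma adj_iff_triangleEdge_or_pendantEdge :
    G.Adj u v ↔ G.TriangleEdge u v ∨ G.PendantEdge u v := by
  unfold TriangleEdge PendantEdge
  rw [← and_or_left, and_iff_left (em _)]

namespace IsLocallyPath

/-- Two of the three neighbors are adjacent, so their edges to `v` lie in a triangle; only the third
neighbor is left. -/
lemma pendantEdge_unique (hG : G.IsLocallyPath) (h₁ : G.PendantEdge v u)
    (h₂ : G.PendantEdge v w) : u = w := by
  obtain ⟨x, y, z, hxy, hxz, hyz, hN, hA, hB⟩ := hG v
  obtain ⟨h₁, h₁'⟩ := h₁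
  obtain ⟨h₂, h₂'⟩ := h₂
  push Not at h₁' h₂'
  have := hA.symm
  grind

lemma outer_structure (hG : G.IsLocallyPath) (hv : G.IsOuter v) :
    ∃ p q, p ≠ q ∧ G.TriangleEdge p q ∧ ∀ x, G.TriangleEdge v x ↔ x = p ∨ x = q := by
  obtain ⟨x, y, z, hxy, hxz, hyz, hN, hA, hB⟩ := hG v
  obtain ⟨w, hw, hw'⟩ := hv
  push Not at hw'
  have h1 := hA.symm
  refine ⟨x, y, hxy, ⟨hA, v, ?_, ?_⟩, fun t ↦ ⟨?_, ?_⟩⟩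
  · exact ((hN x).2 (by simp)).symm
  · exact ((hN y).2 (by simp)).symm
  · rintro ⟨h, s, hs, hs'⟩
    have := hs'.symm
    grind
  · rintro (rfl | rfl)
    · exact ⟨(hN _).2 (by simp), y, (hN _).2 (by simp), hA⟩
    · exact ⟨(hN _).2 (by simp), x, (hN _).2 (by simp), h1⟩

lemma adj_three (hG : G.IsLocallyPath) {a b c d : V} (ha : G.Adj v a) (hb : G.Adj v b)
    (hc : G.Adj v c) (hab : a ≠ b) (hac : a ≠ c) (hbc : b ≠ c) (hd : G.Adj v d) :
    d = a ∨ d = b ∨ d = c := by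
  obtain ⟨x, y, z, hxy, hxz, hyz, hN, hA, hB⟩ := hG v
  grind

lemma exists_third (hG : G.IsLocallyPath) (a b : V) : ∃ c, G.Adj v c ∧ c ≠ a ∧ c ≠ b := by
  obtain ⟨x, y, z, hxy, hxz, hyz, hN, hA, hB⟩ := hG v
  have hx := (hN x).2 (by simp)
  have hy := (hN y).2 (by simp)
  have hz := (hN z).2 (by simp)
  grind

/-- An end of a diamond is outer, and its triangle edges lead to the two inner vertices. -/
lemma diamond_end (hG : G.IsLocallyPath) {c a d : V} (hvc : G.Adj v c) (hva : G.Adj v a)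
    (hvd : G.Adj v d) (hca : G.Adj c a) (hcd : G.Adj c d) (had : ¬ G.Adj a d) (hne : a ≠ d) :
    G.IsOuter a ∧ ∀ x, G.TriangleEdge a x ↔ x = v ∨ x = c := by
  obtain ⟨w, hw, hwv, hwc⟩ := hG.exists_third (v := a) v c
  have hN := fun t ↦ hG.adj_three (d := t) hva.symm hca.symm hw hvc.ne hwv.symm hwc.symm
  have hNv := fun t ↦ hG.adj_three (d := t) hvc hva hvd hca.ne hcd.ne hne
  have hNc := fun t ↦ hG.adj_three (d := t) hvc.symm hca hcd hva.ne hvd.ne hne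
  have hw' : ¬ ∃ t, G.Adj a t ∧ G.Adj w t := by
    rintro ⟨t, h, h'⟩
    rcases hN t h with rfl | rfl | rfl
    · rcases hNv w h'.symm with rfl | rfl | rfl
      · exact hwc rfl
      · exact hw.ne rfl
      · exact had hw
    · rcases hNc w h'.symm with rfl | rfl | rfl
      · exact hwv rfl
      · exact hw.ne rfl
      · exact had hw
    · exact h'.ne rfl
  refine ⟨⟨w, hw, hw'⟩, fun x ↦ ⟨fun ⟨h, h'⟩ ↦ ?_, ?_⟩⟩
  · rcases hN x h with h | h | rfl
    · exact .inl h
    · exact .inr h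
    · exact absurd h' hw'
  · rintro (rfl | rfl)
    · exact ⟨hva.symm, c, hca.symm, hvc⟩
    · exact ⟨hca.symm, v, hva.symm, hvc.symm⟩

lemma inner_structure (hG : G.IsLocallyPath) (hv : ¬ G.IsOuter v) :
    ∃ c a d, a ≠ d ∧ c ≠ a ∧ c ≠ d ∧ v ≠ c ∧ (∀ x, G.TriangleEdge v x ↔ x = c ∨ x = a ∨ x = d) ∧
      ¬ G.IsOuter c ∧ (∀ x, G.TriangleEdge c x ↔ x = v ∨ x = a ∨ x = d) ∧
      G.IsOuter a ∧ (∀ x, G.TriangleEdge a x ↔ x = v ∨ x = c) ∧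
      G.IsOuter d ∧ (∀ x, G.TriangleEdge d x ↔ x = v ∨ x = c) := by
  obtain ⟨c, a, d, hca, hcd, had, hN, hA, hB⟩ := hG v
  -- Without this edge `d` has no common neighbor with `v`, which makes `vd` pendant and `v` outer.
  have hcd' : G.Adj c d := by
    by_contra h
    refine hv ⟨d, (hN d).2 (by simp), fun ⟨t, h1, h2⟩ ↦ ?_⟩
    rcases (hN t).1 h1 with rfl | rfl | rfl
    · exact h h2.symm
    · exact hB h2.symm
    · exact h2.ne rfl
  have hvc := (hN c).2 (by simp)
  have hva := (hN a).2 (by simp)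
  have hvd := (hN d).2 (by simp)
  have hNc := fun t ↦ hG.adj_three (d := t) hvc.symm hA hcd' hva.ne hvd.ne had
  obtain ⟨h1, h2⟩ := hG.diamond_end hvc hva hvd hA hcd' hB had
  obtain ⟨h3, h4⟩ := hG.diamond_end hvc hvd hva hcd' hA (fun h ↦ hB h.symm) had.symm
  have hvT : ∀ x, G.Adj v x → G.TriangleEdge v x := fun x hx ↦ by
    by_contra h
    exact hv ⟨x, (adj_iff_triangleEdge_or_pendantEdge.1 hx).resolve_left h⟩
  have hcT : ∀ x, G.Adj c x → G.TriangleEdge c x := fun x hx ↦ by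
    rcases hNc x hx with rfl | rfl | rfl
    · exact (hvT c hvc).symm
    · exact ((h2 c).2 (.inr rfl)).symm
    · exact ((h4 c).2 (.inr rfl)).symm
  refine ⟨c, a, d, had, hca, hcd, hvc.ne, fun x ↦ ⟨fun h ↦ (hN x).1 h.1, fun h ↦ hvT x ((hN x).2 h)⟩,
    fun ⟨w, hw⟩ ↦ hw.2 (hcT w hw.1).2, fun x ↦ ⟨fun h ↦ hNc x h.1, fun h ↦ hcT x ?_⟩,
    h1, h2, h3, h4⟩
  rcases h with rfl | rfl | rfl
  exacts [hvc.symm, hA, hcd']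

end IsLocallyPath

/-! ### Bipartiteness of a union of two matchings. -/

/-- The union of two partial matchings is bipartite. -/
lemma exists_two_coloring_of_matchings {V : Type*} (R₁ R₂ : V → V → Prop)
    (s₁ : ∀ x y, R₁ x y → R₁ y x) (s₂ : ∀ x y, R₂ x y → R₂ y x)
    (i₁ : ∀ x, ¬ R₁ x x) (i₂ : ∀ x, ¬ R₂ x x)
    (f₁ : ∀ x y z, R₁ x y → R₁ x z → y = z) (f₂ : ∀ x y z, R₂ x y → R₂ x z → y = z) :
    ∃ g : V → Bool, ∀ x y, R₁ x y ∨ R₂ x y → g x ≠ g y := by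
  classical
  -- Doubling the vertex set makes a matching perfect: each unmatched vertex is paired with its own
  -- copy, which gives a fixed-point-free involution.
  have key : ∀ R : V → V → Prop, (∀ x y, R x y → R y x) → (∀ x, ¬ R x x) →
      (∀ x y z, R x y → R x z → y = z) → ∃ σ : Equiv.Perm (V × Bool),
        (∀ x, σ (σ x) = x) ∧ (∀ x, σ x ≠ x) ∧ ∀ x y i, R x y → σ (x, i) = (y, i) := by
    intro R s irr f
    let τ : V × Bool → V × Bool := fun x ↦
      if h : ∃ y, R x.1 y then (h.choose, x.2) else (x.1, !x.2)
    have hτ : ∀ x y i, R x y → τ (x, i) = (y, i) := by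
      intro x y i h
      have h' : ∃ y, R x y := ⟨y, h⟩
      simp only [τ, h', dif_pos]
      rw [f x _ y h'.choose_spec h]
    have hτ' : ∀ x i, (¬ ∃ y, R x y) → τ (x, i) = (x, !i) := by
      intro x i h
      simp only [τ, h, dif_neg, not_false_iff]
    have hinv : Function.Involutive τ := by
      rintro ⟨x, i⟩
      by_cases h : ∃ y, R x y
      · obtain ⟨y, h⟩ := h
        rw [hτ x y i h, hτ y x i (s _ _ h)]
      · rw [hτ' x i h, hτ' x _ h, Bool.not_not]
    refine ⟨hinv.toPerm, hinv, ?_, hτ⟩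
    rintro ⟨x, i⟩ h
    change τ (x, i) = (x, i) at h
    by_cases h' : ∃ y, R x y
    · obtain ⟨y, h'⟩ := h'
      rw [hτ x y i h'] at h
      have : y = x := congrArg Prod.fst h
      exact irr x (this ▸ h')
    · rw [hτ' x i h'] at h
      simpa using congrArg Prod.snd h
  obtain ⟨σ, σσ, σne, hσ⟩ := key R₁ s₁ i₁ f₁
  obtain ⟨τ, ττ, τne, hτ⟩ := key R₂ s₂ i₂ f₂
  set ρ := σ * τ with hρ
  have hσinv : σ⁻¹ = σ := by ext1 x; rw [Equiv.Perm.inv_eq_iff_eq, σσ]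
  have hτinv : τ⁻¹ = τ := by ext1 x; rw [Equiv.Perm.inv_eq_iff_eq, ττ]
  have hconj : ∀ n : ℤ, σ * ρ ^ n = ρ ^ (-n) * σ := by
    intro n
    have : σ * ρ * σ⁻¹ = ρ⁻¹ := by
      rw [hρ, mul_inv_rev, hσinv, hτinv, ← mul_assoc]
      have : σ * σ = 1 := by ext1 x; exact σσ x
      rw [this, one_mul]
    have h2 := conj_zpow (i := n) (a := σ) (b := ρ)
    rw [this, inv_zpow'] at h2
    rw [h2]; group
  have hτeq : τ = σ * ρ := by
    rw [hρ, ← mul_assoc]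
    have : σ * σ = 1 := by ext1 x; exact σσ x
    rw [this, one_mul]
  -- Since `σ` inverts `ρ`, an equality `ρ ^ n x = σ x` makes the midpoint `ρ ^ m x` a fixed point
  -- of `σ` (`n = 2m`) or of `τ` (`n = 2m + 1`).
  have hcyc : ∀ x, ¬ ρ.SameCycle x (σ x) := by
    rintro x ⟨n, hn⟩
    rcases Int.even_or_odd' n with ⟨m, rfl | rfl⟩
    · apply σne ((ρ ^ m) x)
      rw [← Equiv.Perm.mul_apply, hconj, Equiv.Perm.mul_apply, ← hn, ← Equiv.Perm.mul_apply,
        ← zpow_add]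
      congr 2; ring
    · apply τne ((ρ ^ m) x)
      rw [hτeq, ← Equiv.Perm.mul_apply, mul_assoc, ← zpow_one_add, hconj, Equiv.Perm.mul_apply, ← hn,
        ← Equiv.Perm.mul_apply, ← zpow_add]
      congr 2; ring
  have hσcyc : ∀ x y, ρ.SameCycle x y → ρ.SameCycle (σ x) (σ y) := by
    rintro x y ⟨n, rfl⟩
    refine ⟨-n, ?_⟩
    rw [← Equiv.Perm.mul_apply, ← Equiv.Perm.mul_apply, hconj]
  let Q := Quotient (Equiv.Perm.SameCycle.setoid ρ)
  let π : V × Bool → Q := Quotient.mk _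
  have hπ : ∀ x y, π x = π y ↔ ρ.SameCycle x y := fun x y ↦ Quotient.eq
  obtain ⟨lt, hlt⟩ : ∃ lt : Q → Q → Prop, ∀ a b, a ≠ b → (lt a b ↔ ¬ lt b a) := by
    refine ⟨WellOrderingRel, fun a b hab ↦ ⟨fun h h' ↦ asymm h h', fun h ↦ ?_⟩⟩
    rcases trichotomous_of WellOrderingRel a b with h' | h' | h'
    exacts [h', absurd h' hab, absurd h' h]
  have hπτ : ∀ x, π (τ x) = π (σ x) := by
    intro x
    rw [hπ]
    refine ⟨1, ?_⟩
    rw [zpow_one, hρ, Equiv.Perm.mul_apply, ττ]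
  -- Both involutions exchange the same two distinct `ρ`-cycles, so the color records which of the
  -- two comes first.
  let g : V × Bool → Bool := fun x ↦ decide (lt (π x) (π (σ x)))
  have hg : ∀ x y, π y = π (σ x) → g x ≠ g y := by
    intro x y h
    have h1 : π (σ y) = π x := by
      rw [hπ] at h ⊢
      simpa [σσ] using hσcyc _ _ h
    have h2 : π x ≠ π (σ x) := fun h ↦ hcyc x ((hπ _ _).1 h)
    have := hlt _ _ h2
    simp only [g, h1, h, ne_eq, decide_eq_decide]
    tauto
  refine ⟨fun v ↦ g (v, false), fun x y h ↦ hg _ _ ?_⟩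
  rcases h with h | h
  · rw [hσ x y false h]
  · rw [← hτ x y false h, hπτ]

end SimpleGraph

namespace SimpleGraph

/-! ### Selecting a vertex and a color in each lone triangle. -/

/-- A vertex whose unique triangle is not part of a diamond. -/
def IsLoneTriangleVertex {V : Type*} (G : SimpleGraph V) (v : V) : Prop :=
  G.IsOuter v ∧ ∀ p, G.TriangleEdge v p → G.IsOuter p

/-- The parity of the number of steps of `next` along which `rank` decreases. -/
def descentParity {V : Type*} (rank : V → ℕ) (next : V → V) (v : V) : Bool :=
  if rank (next v) < rank v then !descentParity rank next (next v) else true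
termination_by rank v

variable {V : Type*} {G : SimpleGraph V} {u v w : V}

lemma Connected.exists_adj_dist_lt (hG : G.Connected) (h : v ≠ u) :
    ∃ w, G.Adj v w ∧ G.dist w u < G.dist v u := by
  obtain ⟨p, hp⟩ := hG.exists_walk_length_eq_dist v u
  cases p with
  | nil => exact absurd rfl h
  | cons hvw q =>
    refine ⟨_, hvw, ?_⟩
    have := G.dist_le q
    rw [Walk.length_cons] at hp
    omega

lemma TriangleEdge.ne (h : G.TriangleEdge u v) : u ≠ v := h.1.ne

lemma IsLocallyPath.triangleEdge_trans (hG : G.IsLocallyPath) (hv : G.IsOuter v)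
    (hu : G.TriangleEdge v u) (hw : G.TriangleEdge v w) (huw : u ≠ w) : G.TriangleEdge u w := by
  obtain ⟨p, q, hpq, h, hN⟩ := hG.outer_structure hv
  have := h.symm
  grind

lemma IsLocallyPath.isLoneTriangleVertex_of_triangleEdge (hG : G.IsLocallyPath)
    (hv : G.IsLoneTriangleVertex v) (h : G.TriangleEdge v u) : G.IsLoneTriangleVertex u := by
  refine ⟨hv.2 u h, fun p hp ↦ ?_⟩
  by_cases hpv : p = v
  · exact hpv ▸ hv.1
  · exact hv.2 p (hG.triangleEdge_trans (hv.2 u h) h.symm hp (Ne.symm hpv))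

lemma not_triangleEdge_of_pendantEdge (h : G.PendantEdge u v) : ¬ G.TriangleEdge u v :=
  fun h' ↦ h.2 h'.2

/-- In each lone triangle one may select a vertex and a color, so that triangles joined by the
pendant edge of a selected vertex receive different colors. -/
lemma IsLocallyPath.exists_selection [Finite V] (hG : G.IsLocallyPath) (hc : G.Connected) :
    ∃ (P : V → Prop) (κ : V → Bool),
      (∀ v, P v → G.IsLoneTriangleVertex v) ∧
      (∀ v, G.IsLoneTriangleVertex v → ∃ x, (x = v ∨ G.TriangleEdge v x) ∧ P x) ∧
      (∀ v w, P v → G.TriangleEdge v w → ¬ P w) ∧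
      (∀ v w, G.IsLoneTriangleVertex v → G.TriangleEdge v w → κ v = κ w) ∧
      (∀ v w, P v → G.PendantEdge v w → G.IsLoneTriangleVertex w → κ v ≠ κ w) := by
  classical
  obtain ⟨r⟩ := hc.nonempty
  obtain ⟨n, ⟨e⟩⟩ := Finite.exists_equiv_fin V
  -- The label `e v` breaks ties in the distance, so all vertices of a lone triangle pick the same
  -- minimum.
  let key : V → ℕ ×ₗ Fin n := fun v ↦ toLex (G.dist v r, e v)
  have key_inj : ∀ x y, key x = key y → x = y := fun x y h ↦
    e.injective (congrArg Prod.snd (toLex.injective h))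
  have key_dist : ∀ x y, key x ≤ key y → G.dist x r ≤ G.dist y r := fun x y h ↦ by
    rcases Prod.Lex.le_iff.1 h with h | h
    exacts [h.le, h.1.le]
  let B : V → Set V := fun v ↦ {x | x = v ∨ G.TriangleEdge v x}
  have hpick : ∀ v, ∃ x ∈ B v, ∀ y ∈ B v, key x ≤ key y := fun v ↦
    Set.exists_min_image (B v) key (Set.toFinite _) ⟨v, .inl rfl⟩
  choose pick pick_mem pick_min using hpick
  have hB : ∀ v w, G.IsLoneTriangleVertex v → G.TriangleEdge v w → B v = B w := by
    intro v w hv hvw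
    have hw := hG.isLoneTriangleVertex_of_triangleEdge hv hvw
    ext x
    simp only [B, Set.mem_ofPred_eq]
    constructor
    · rintro (rfl | h)
      · exact .inr hvw.symm
      · exact or_iff_not_imp_left.2 fun hne ↦ hG.triangleEdge_trans hv.1 hvw h (Ne.symm hne)
    · rintro (rfl | h)
      · exact .inr hvw
      · exact or_iff_not_imp_left.2 fun hne ↦
          hG.triangleEdge_trans hw.1 hvw.symm h (Ne.symm hne)
  have pick_unique : ∀ v x, x ∈ B v → (∀ y ∈ B v, key x ≤ key y) → x = pick v :=
    fun v x hx h ↦ key_inj _ _ (le_antisymm (h _ (pick_mem v)) (pick_min v _ hx))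
  have pick_eq : ∀ v w, G.IsLoneTriangleVertex v → G.TriangleEdge v w → pick v = pick w := by
    intro v w hv hvw
    have h := hB v w hv hvw
    exact pick_unique w _ (h ▸ pick_mem v) (h ▸ pick_min v)
  have pick_lone : ∀ v, G.IsLoneTriangleVertex v → G.IsLoneTriangleVertex (pick v) := by
    intro v hv
    rcases pick_mem v with h | h
    · rwa [h]
    · exact hG.isLoneTriangleVertex_of_triangleEdge hv h
  have hpend : ∀ v, ∃ w, G.IsOuter v → G.PendantEdge v w := fun v ↦ by
    by_cases h : G.IsOuter v
    · exact ⟨h.choose, fun _ ↦ h.choose_spec⟩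
    · exact ⟨v, fun h' ↦ absurd h' h⟩
  choose σ hσ using hpend
  set rank : V → ℕ := fun v ↦ G.dist (pick v) r with hrank
  set next : V → V := fun v ↦ σ (pick v) with hnext
  have rank_le : ∀ v, rank v ≤ G.dist v r := fun v ↦ key_dist _ _ (pick_min v v (.inl rfl))
  -- A neighbor of `pick v` closer to the root cannot lie in the triangle, by minimality, so it is
  -- reached by the pendant edge.
  have hpos : ∀ v, G.IsLoneTriangleVertex v → pick v ≠ r → rank (next v) < rank v := by
    intro v hv hne
    obtain ⟨w, hw, hlt⟩ := hc.exists_adj_dist_lt hne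
    have hl := pick_lone v hv
    rcases adj_iff_triangleEdge_or_pendantEdge.1 hw with h | h
    · have h1 : w ∈ B v := by
        rcases pick_mem v with h' | h'
        · rw [h'] at h; exact .inr h
        · rw [hB v _ hv h']; exact .inr h
      exact absurd (key_dist _ _ (pick_min v w h1)) (not_le.2 hlt)
    · have : next v = w := hG.pendantEdge_unique (hσ _ hl.1) h
      rw [this]
      exact (rank_le w).trans_lt hlt
  refine ⟨fun v ↦ G.IsLoneTriangleVertex v ∧ pick v = v, descentParity rank next, fun v h ↦ h.1,
    fun v hv ↦ ⟨pick v, pick_mem v, pick_lone v hv, ?_⟩, ?_, ?_, ?_⟩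
  · rcases pick_mem v with h | h
    · rw [h, h]
    · exact (pick_eq v _ hv h).symm
  · rintro v w ⟨hv, hpv⟩ hvw ⟨hw, hpw⟩
    exact hvw.ne (by rw [← hpv, ← hpw, pick_eq v w hv hvw])
  · intro v w hv hvw
    rw [descentParity.eq_1 rank next v, descentParity.eq_1 rank next w]
    simp only [hrank, hnext, pick_eq v w hv hvw]
  · rintro v w ⟨hv, hpv⟩ hvw hw
    have hnv : next v = w := by
      rw [hnext]; simp only [hpv]
      exact hG.pendantEdge_unique (hσ _ hv.1) hvw
    -- The root's triangle is the only one whose step need not descend. If its pendant edge ends in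
    -- a lone triangle, that triangle picks the endpoint and steps back to the root, so the colors
    -- still differ.
    by_cases hvr : v = r
    · have hwr : pick w = w := by
        by_contra hne
        have h := (pick_mem w).resolve_left hne
        have hpr : pick w ≠ r := by
          intro h'
          rw [h', ← hvr] at h
          exact not_triangleEdge_of_pendantEdge hvw h.symm
        have h1 : G.Adj w r := hvr ▸ hvw.1.symm
        have h2 : rank w ≤ 1 := (rank_le w).trans (dist_eq_one_iff_adj.2 h1).le
        obtain ⟨y, hy, hlt⟩ := hc.exists_adj_dist_lt hpr
        have h3 : y = r := hc.dist_eq_zero_iff.1 (by simp only [hrank] at h2; omega)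
        subst h3
        exact hvw.2 ⟨pick w, hvr ▸ hy.symm, h.1⟩
      have hnw : next w = v := by
        rw [hnext]; simp only [hwr]
        exact hG.pendantEdge_unique (hσ _ hw.1) hvw.symm
      have := hpos w hw (by rw [hwr, ← hvr]; exact hvw.1.ne')
      rw [descentParity.eq_1 rank next w, if_pos this, hnw]
      simp
    · have := hpos v hv (by rwa [hpv])
      rw [descentParity.eq_1 rank next v, if_pos this, hnv]
      simp

end SimpleGraph

namespace SimpleGraph

/-! ### Extending the two packings into the diamonds. -/

/-- `b`, `c` are the inner vertices and `a`, `d` the ends of a diamond. -/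
structure IsDiamond {V : Type*} (G : SimpleGraph V) (b c a d : V) : Prop where
  ends_ne : a ≠ d
  inner_ne : b ≠ c
  left_inner : ¬ G.IsOuter b
  right_inner : ¬ G.IsOuter c
  left_outer : G.IsOuter a
  right_outer : G.IsOuter d
  left_inner_iff : ∀ x, G.TriangleEdge b x ↔ x = c ∨ x = a ∨ x = d
  right_inner_iff : ∀ x, G.TriangleEdge c x ↔ x = b ∨ x = a ∨ x = d
  left_outer_iff : ∀ x, G.TriangleEdge a x ↔ x = b ∨ x = c
  right_outer_iff : ∀ x, G.TriangleEdge d x ↔ x = b ∨ x = c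

/-- A choice of one vertex in each lone triangle and of a color for each lone triangle, such that
triangles joined by the pendant edge of a chosen vertex have different colors. -/
structure IsSelection {V : Type*} (G : SimpleGraph V) (P : V → Prop) (κ : V → Bool) : Prop where
  lone : ∀ v, P v → G.IsLoneTriangleVertex v
  exists_mem : ∀ v, G.IsLoneTriangleVertex v → ∃ x, (x = v ∨ G.TriangleEdge v x) ∧ P x
  not_mem : ∀ v w, P v → G.TriangleEdge v w → ¬ P w
  color_eq : ∀ v w, G.IsLoneTriangleVertex v → G.TriangleEdge v w → κ v = κ w
  color_ne : ∀ v w, P v → G.PendantEdge v w → G.IsLoneTriangleVertex w → κ v ≠ κ w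

/-- The pendant edge at `a` leads to a selected vertex of color `k`. -/
def SeesColor {V : Type*} (G : SimpleGraph V) (P : V → Prop) (κ : V → Bool) (k : Bool) (a : V) :
    Prop := ∃ w, G.PendantEdge a w ∧ P w ∧ κ w = k

/-- Some end of the diamond around the inner vertex `b` sees the color `k`. -/
def EndSeesColor {V : Type*} (G : SimpleGraph V) (P : V → Prop) (κ : V → Bool) (k : Bool) (b : V) :
    Prop := ∃ a, G.TriangleEdge b a ∧ G.SeesColor P κ k a

/-- The vertices of color `k` among the selected vertices and the diamond vertices added to them;
`F` selects one inner vertex in each diamond. -/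
def InPacking {V : Type*} (G : SimpleGraph V) (P : V → Prop) (κ : V → Bool) (F : V → Prop)
    (k : Bool) (v : V) : Prop :=
  (P v ∧ κ v = k) ∨
  -- If the ends see no color, both inner vertices are colored, differently; if they see exactly
  -- one, the vertex in `F` takes the other.
  (¬ G.IsOuter v ∧ ¬ G.EndSeesColor P κ k v ∧
    (F v ∧ (k = true ∨ G.EndSeesColor P κ true v) ∨
    ¬ F v ∧ k = false ∧ ¬ G.EndSeesColor P κ true v)) ∨
  -- If the ends see both colors, neither inner vertex can be colored; each end takes the color
  -- opposite to the one it sees.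
  (G.SeesColor P κ (!k) v ∧ ∃ b, G.TriangleEdge v b ∧ ¬ G.IsOuter b ∧
    G.EndSeesColor P κ true b ∧ G.EndSeesColor P κ false b)

variable {V : Type*} {G : SimpleGraph V} {P F : V → Prop} {κ : V → Bool} {k : Bool}
  {a b c d u v w : V}

lemma IsDiamond.swap_ends (h : G.IsDiamond b c a d) : G.IsDiamond b c d a :=
  ⟨h.ends_ne.symm, h.inner_ne, h.left_inner, h.right_inner, h.right_outer, h.left_outer,
    fun x ↦ by rw [h.left_inner_iff]; tauto, fun x ↦ by rw [h.right_inner_iff]; tauto,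
    h.right_outer_iff, h.left_outer_iff⟩

lemma IsDiamond.swap_inner (h : G.IsDiamond b c a d) : G.IsDiamond c b a d :=
  ⟨h.ends_ne, h.inner_ne.symm, h.right_inner, h.left_inner, h.left_outer, h.right_outer,
    h.right_inner_iff, h.left_inner_iff, fun x ↦ by rw [h.left_outer_iff]; tauto,
    fun x ↦ by rw [h.right_outer_iff]; tauto⟩

lemma IsLocallyPath.exists_isDiamond (hG : G.IsLocallyPath) (hb : ¬ G.IsOuter b) :
    ∃ c a d, G.IsDiamond b c a d := by
  obtain ⟨c, a, d, had, -, -, hbc, hb', hc, hc', ha, ha', hd, hd'⟩ := hG.inner_structure hb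
  exact ⟨c, a, d, had, hbc, hb, hc, ha, hd, hb', hc', ha', hd'⟩

lemma IsLocallyPath.exists_isDiamond_of_triangleEdge (hG : G.IsLocallyPath) (ha : G.IsOuter a)
    (h : G.TriangleEdge a b) (hb : ¬ G.IsOuter b) : ∃ c d, G.IsDiamond b c a d := by
  obtain ⟨c, x, y, hD⟩ := hG.exists_isDiamond hb
  rcases (hD.left_inner_iff a).1 h.symm with rfl | rfl | rfl
  · exact absurd ha hD.right_inner
  · exact ⟨c, y, hD⟩
  · exact ⟨c, x, hD.swap_ends⟩

lemma PendantEdge.isOuter_left (h : G.PendantEdge u v) : G.IsOuter u := ⟨v, h⟩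

lemma PendantEdge.isOuter_right (h : G.PendantEdge u v) : G.IsOuter v := ⟨u, h.symm⟩

lemma SeesColor.isOuter (h : G.SeesColor P κ k a) : G.IsOuter a := by
  obtain ⟨w, h, -⟩ := h; exact h.isOuter_left

lemma IsDiamond.not_lone_end (h : G.IsDiamond b c a d) : ¬ G.IsLoneTriangleVertex a :=
  fun h' ↦ h.left_inner (h'.2 b ((h.left_outer_iff b).2 (.inl rfl)))

lemma IsDiamond.endSeesColor_iff (h : G.IsDiamond b c a d) :
    G.EndSeesColor P κ k b ↔ G.SeesColor P κ k a ∨ G.SeesColor P κ k d := by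
  constructor
  · rintro ⟨x, hx, hs⟩
    rcases (h.left_inner_iff x).1 hx with rfl | rfl | rfl
    · exact absurd hs.isOuter h.right_inner
    · exact .inl hs
    · exact .inr hs
  · rintro (hs | hs)
    · exact ⟨a, (h.left_inner_iff a).2 (by simp), hs⟩
    · exact ⟨d, (h.left_inner_iff d).2 (by simp), hs⟩

lemma IsDiamond.endSeesColor_congr (h : G.IsDiamond b c a d) :
    G.EndSeesColor P κ k b ↔ G.EndSeesColor P κ k c := by
  rw [h.endSeesColor_iff, h.swap_inner.endSeesColor_iff]

lemma IsLocallyPath.seesColor_unique (hG : G.IsLocallyPath) {k l : Bool}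
    (h : G.SeesColor P κ k a) (h' : G.SeesColor P κ l a) : k = l := by
  obtain ⟨x, hx, -, rfl⟩ := h
  obtain ⟨y, hy, -, rfl⟩ := h'
  rw [hG.pendantEdge_unique hx hy]

lemma IsDiamond.adj_inner (h : G.IsDiamond b c a d) (hv : G.Adj b v) : v = c ∨ v = a ∨ v = d := by
  rcases adj_iff_triangleEdge_or_pendantEdge.1 hv with h' | h'
  · exact (h.left_inner_iff v).1 h'
  · exact absurd h'.isOuter_left h.left_inner

lemma IsDiamond.adj_end (h : G.IsDiamond b c a d) (hv : G.Adj a v) :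
    v = b ∨ v = c ∨ G.PendantEdge a v := by
  rcases adj_iff_triangleEdge_or_pendantEdge.1 hv with h' | h'
  · have := (h.left_outer_iff v).1 h'; tauto
  · tauto

lemma IsDiamond.near_inner (h : G.IsDiamond b c a d)
    (hv : G.Adj b v ∨ ∃ w, G.Adj b w ∧ G.Adj v w) :
    v = b ∨ v = c ∨ v = a ∨ v = d ∨ G.PendantEdge a v ∨ G.PendantEdge d v := by
  rcases hv with hv | ⟨w, hw, hv⟩
  · have := h.adj_inner hv; tauto
  · rcases h.adj_inner hw with rfl | rfl | rfl
    · have := h.swap_inner.adj_inner hv.symm; tauto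
    · have := h.adj_end hv.symm; tauto
    · have := h.swap_ends.adj_end hv.symm; tauto

/-- With `near_inner`, this lists the ball of radius two around a diamond vertex, reducing the
distance condition to a finite check. -/
lemma IsLocallyPath.near_end (hG : G.IsLocallyPath) (h : G.IsDiamond b c a d)
    (hv : G.Adj a v ∨ ∃ w, G.Adj a w ∧ G.Adj v w) :
    v = a ∨ v = b ∨ v = c ∨ v = d ∨ G.PendantEdge a v ∨
      ∃ w, G.PendantEdge a w ∧ G.TriangleEdge w v := by
  rcases hv with hv | ⟨w, hw, hv⟩
  · have := h.adj_end hv; tauto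
  · rcases h.adj_end hw with rfl | rfl | h'
    · have := h.adj_inner hv.symm; tauto
    · have := h.swap_inner.adj_inner hv.symm; tauto
    · rcases adj_iff_triangleEdge_or_pendantEdge.1 hv.symm with h'' | h''
      · exact .inr (.inr (.inr (.inr (.inr ⟨w, h', h''⟩))))
      · exact .inl (hG.pendantEdge_unique h'' h'.symm)

/-- Vertices of the same color are equal if they are at distance at most two. -/
lemma IsLocallyPath.inPacking_eq_of_near (hG : G.IsLocallyPath) (hS : G.IsSelection P κ)
    (hF : ∀ b c a d, G.IsDiamond b c a d → (F b ↔ ¬ F c))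
    (hu : G.InPacking P κ F k u) (hv : G.InPacking P κ F k v)
    (h : G.Adj u v ∨ ∃ w, G.Adj u w ∧ G.Adj v w) : u = v := by
  have triangle_triangle : ∀ u v, (P u ∧ κ u = k) → (P v ∧ κ v = k) →
      (G.Adj u v ∨ ∃ w, G.Adj u w ∧ G.Adj v w) → u = v := by
    rintro u v ⟨hu, hku⟩ ⟨hv, hkv⟩ h
    have hT := hS.not_mem
    have key : ∀ x y w, P x → P y → κ x = k → κ y = k → G.PendantEdge x w →
        ¬ (w = y ∨ G.TriangleEdge w y) := by
      intro x y w hx hy hkx hky hxw hwy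
      have hl := hS.lone y hy
      rcases hwy with rfl | hwy
      · exact hS.color_ne x w hx hxw hl (hkx.trans hky.symm)
      · refine hS.color_ne x w hx hxw
          (hG.isLoneTriangleVertex_of_triangleEdge hl hwy.symm) ?_
        rw [hkx, ← hky]
        exact hS.color_eq y w hl hwy.symm
    rcases h with h | ⟨w, huw, hvw⟩
    · rcases adj_iff_triangleEdge_or_pendantEdge.1 h with h | h
      · exact absurd hv (hT u v hu h)
      · exact absurd (.inl rfl) (key u v v hu hv hku hkv h)
    · rcases adj_iff_triangleEdge_or_pendantEdge.1 huw with h1 | h1 <;>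
      rcases adj_iff_triangleEdge_or_pendantEdge.1 hvw with h2 | h2
      · by_contra hne
        exact hT u v hu (hG.triangleEdge_trans
          (hG.isLoneTriangleVertex_of_triangleEdge (hS.lone u hu) h1).1 h1.symm h2.symm hne) hv
      · exact absurd (.inr h1.symm) (key v u w hv hu hkv hku h2)
      · exact absurd (.inr h2.symm) (key u v w hu hv hku hkv h1)
      · exact hG.pendantEdge_unique h1.symm h2.symm
  have triangle_inner : ∀ u b, (P u ∧ κ u = k) → ¬ G.IsOuter b → ¬ G.EndSeesColor P κ k b →
      ¬ (G.Adj b u ∨ ∃ w, G.Adj b w ∧ G.Adj u w) := by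
    rintro u b ⟨hu, hku⟩ hb hs h
    obtain ⟨c, a, d, hD⟩ := hG.exists_isDiamond hb
    have hl := hS.lone u hu
    rcases hD.near_inner h with rfl | rfl | rfl | rfl | h | h
    · exact hb hl.1
    · exact hD.right_inner hl.1
    · exact hD.not_lone_end hl
    · exact hD.swap_ends.not_lone_end hl
    · exact hs (hD.endSeesColor_iff.2 (.inl ⟨u, h, hu, hku⟩))
    · exact hs (hD.endSeesColor_iff.2 (.inr ⟨u, h, hu, hku⟩))
  have triangle_end : ∀ u b c a d, (P u ∧ κ u = k) → G.IsDiamond b c a d →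
      G.SeesColor P κ (!k) a → ¬ (G.Adj a u ∨ ∃ w, G.Adj a w ∧ G.Adj u w) := by
    rintro u b c a d ⟨hu, hku⟩ hD hs h
    have hl := hS.lone u hu
    rcases hG.near_end hD h with rfl | rfl | rfl | rfl | h | ⟨w, h, h'⟩
    · exact hD.not_lone_end hl
    · exact hD.left_inner hl.1
    · exact hD.right_inner hl.1
    · exact hD.swap_ends.not_lone_end hl
    · simpa using hG.seesColor_unique hs ⟨u, h, hu, hku⟩
    · obtain ⟨w', hw', hP, -⟩ := hs
      obtain rfl := hG.pendantEdge_unique h hw'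
      exact hS.not_mem w u hP h' hu
  have inner_end : ∀ u b c a d, ¬ G.IsOuter u → ¬ G.EndSeesColor P κ k u → G.IsDiamond b c a d →
      G.SeesColor P κ (!k) a → G.EndSeesColor P κ true b → G.EndSeesColor P κ false b →
      ¬ (G.Adj a u ∨ ∃ w, G.Adj a w ∧ G.Adj u w) := by
    intro u b c a d hu hs hD hsa ht hf h
    have hk : G.EndSeesColor P κ k b := by cases k <;> assumption
    rcases hG.near_end hD h with rfl | rfl | rfl | rfl | h | ⟨w, h, h'⟩
    · exact hu hD.left_outer
    · exact hs hk
    · exact hs (hD.endSeesColor_congr.1 hk)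
    · exact hu hD.right_outer
    · exact hu h.isOuter_right
    · obtain ⟨w', hw', hP, -⟩ := hsa
      obtain rfl := hG.pendantEdge_unique h hw'
      exact hu ((hS.lone w hP).2 u h')
  have hsymm : G.Adj v u ∨ ∃ w, G.Adj v w ∧ G.Adj u w := by
    rcases h with h | ⟨w, h, h'⟩
    exacts [.inl h.symm, .inr ⟨w, h', h⟩]
  rcases hu with hu | ⟨hu, hu', hu''⟩ | ⟨hu, b, hub, hb, ht, hf⟩
  · rcases hv with hv | ⟨hv, hv', -⟩ | ⟨hv, b, hvb, hb, -, -⟩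
    · exact triangle_triangle u v hu hv h
    · exact absurd hsymm (triangle_inner u v hu hv hv')
    · obtain ⟨c, d, hD⟩ := hG.exists_isDiamond_of_triangleEdge hv.isOuter hvb hb
      exact absurd hsymm (triangle_end u b c v d hu hD hv)
  · rcases hv with hv | ⟨hv, hv', hv''⟩ | ⟨hv, b, hvb, hb, ht, hf⟩
    · exact absurd h (triangle_inner v u hv hu hu')
    · obtain ⟨c, a, d, hD⟩ := hG.exists_isDiamond hu
      have hF' := hF _ _ _ _ hD
      have hA := fun k ↦ hD.endSeesColor_congr (P := P) (κ := κ) (k := k)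
      rcases hD.near_inner h with rfl | rfl | rfl | rfl | h | h
      · rfl
      · rw [← hA] at hv'
        simp only [← hA] at hv''
        exfalso
        cases k <;> simp at hu'' hv'' <;> tauto
      · exact absurd hD.left_outer hv
      · exact absurd hD.right_outer hv
      · exact absurd h.isOuter_right hv
      · exact absurd h.isOuter_right hv
    · obtain ⟨c, d, hD⟩ := hG.exists_isDiamond_of_triangleEdge hv.isOuter hvb hb
      exact absurd hsymm (inner_end u b c v d hu hu' hD hv ht hf)
  · obtain ⟨c, d, hD⟩ := hG.exists_isDiamond_of_triangleEdge hu.isOuter hub hb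
    rcases hv with hv | ⟨hv, hv', -⟩ | ⟨hv, b', hvb, hb', -, -⟩
    · exact absurd h (triangle_end v b c u d hv hD hu)
    · exact absurd h (inner_end v b c u d hv hv' hD hu ht hf)
    · obtain ⟨c', d', hD'⟩ := hG.exists_isDiamond_of_triangleEdge hv.isOuter hvb hb'
      rcases hG.near_end hD h with rfl | rfl | rfl | rfl | h | ⟨w, h, h'⟩
      · rfl
      · exact absurd hv.isOuter hb
      · exact absurd hv.isOuter hD.right_inner
      -- Both ends would see `!k`, yet one of them must see `k`, and an end sees at most one color.
      · have hk : G.EndSeesColor P κ k b := by cases k <;> assumption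
        rcases hD.endSeesColor_iff.1 hk with hk | hk
        · simpa using hG.seesColor_unique hu hk
        · simpa using hG.seesColor_unique hv hk
      · obtain ⟨w, hw, hP, -⟩ := hu
        obtain rfl := hG.pendantEdge_unique h hw
        exact absurd (hS.lone _ hP) hD'.not_lone_end
      · obtain ⟨w', hw, hP, -⟩ := hu
        obtain rfl := hG.pendantEdge_unique h hw
        exact absurd (hG.isLoneTriangleVertex_of_triangleEdge (hS.lone _ hP) h') hD'.not_lone_end

/-! ### Two-coloring the remaining vertices. -/

/-- An end of a diamond whose pendant edge leads to a selected vertex. -/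
def IsExposedEnd {V : Type*} (G : SimpleGraph V) (P : V → Prop) (v : V) : Prop :=
  (∃ b, G.TriangleEdge v b ∧ ¬ G.IsOuter b) ∧ ∃ w, G.PendantEdge v w ∧ P w

/-- If the inner vertex `b` is uncolored, then either the other inner vertex is colored and some end
is exposed, or both ends are exposed. -/
lemma IsDiamond.of_not_inPacking (h : G.IsDiamond b c a d) (hG : G.IsLocallyPath)
    (hF : ∀ b c a d, G.IsDiamond b c a d → (F b ↔ ¬ F c)) (hb : ∀ k, ¬ G.InPacking P κ F k b) :
    ((∃ k, G.InPacking P κ F k c) ∧ (G.IsExposedEnd P a ∨ G.IsExposedEnd P d)) ∨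
      (G.IsExposedEnd P a ∧ G.IsExposedEnd P d ∧
        G.EndSeesColor P κ true b ∧ G.EndSeesColor P κ false b) := by
  have ha : ∀ k, G.SeesColor P κ k a → G.IsExposedEnd P a := fun k ⟨w, hw, hP, _⟩ ↦
    ⟨⟨b, (h.left_outer_iff b).2 (.inl rfl), h.left_inner⟩, w, hw, hP⟩
  have hd : ∀ k, G.SeesColor P κ k d → G.IsExposedEnd P d := fun k ⟨w, hw, hP, _⟩ ↦
    ⟨⟨b, (h.right_outer_iff b).2 (.inl rfl), h.left_inner⟩, w, hw, hP⟩
  have had : ∀ k, G.EndSeesColor P κ k b → G.IsExposedEnd P a ∨ G.IsExposedEnd P d := fun k hk ↦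
    (h.endSeesColor_iff.1 hk).imp (ha k) (hd k)
  have hA := fun k ↦ h.endSeesColor_congr (P := P) (κ := κ) (k := k)
  have hF' := hF _ _ _ _ h
  have h1 := fun h' ↦ hb true (.inr (.inl h'))
  have h2 := fun h' ↦ hb false (.inr (.inl h'))
  have h3 : _ → G.InPacking P κ F true c := fun h' ↦ .inr (.inl h')
  have h4 : _ → G.InPacking P κ F false c := fun h' ↦ .inr (.inl h')
  simp only [← hA, h.left_inner, h.right_inner, not_false_eq_true, true_and, true_or, and_true,
    reduceCtorEq, false_or, false_and, Bool.exists_bool] at h1 h2 h3 h4 ⊢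
  by_cases ht : G.EndSeesColor P κ true b <;> by_cases hf : G.EndSeesColor P κ false b
  · right
    rcases h.endSeesColor_iff.1 ht with h5 | h5 <;> rcases h.endSeesColor_iff.1 hf with h6 | h6
    · simpa using hG.seesColor_unique h5 h6
    · exact ⟨ha _ h5, hd _ h6, ht, hf⟩
    · exact ⟨ha _ h6, hd _ h5, ht, hf⟩
    · simpa using hG.seesColor_unique h5 h6
  · left; have := had _ ht; tauto
  · left; have := had _ hf; tauto
  · exfalso; tauto

/-- The uncolored vertices induce a bipartite graph. -/
lemma IsLocallyPath.exists_two_coloring (hG : G.IsLocallyPath) (hS : G.IsSelection P κ)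
    (hF : ∀ b c a d, G.IsDiamond b c a d → (F b ↔ ¬ F c)) :
    ∃ g : V → Bool, ∀ u v, (∀ k, ¬ G.InPacking P κ F k u) → (∀ k, ¬ G.InPacking P κ F k v) →
      G.Adj u v → g u ≠ g v := by
  classical
  let X : V → Prop := fun v ↦ (∀ k, ¬ G.InPacking P κ F k v) ∧ ¬ G.IsExposedEnd P v
  have hP : ∀ v, P v → ¬ ∀ k, ¬ G.InPacking P κ F k v := fun v hv h ↦ h (κ v) (.inl ⟨hv, rfl⟩)
  obtain ⟨g, hg⟩ := exists_two_coloring_of_matchings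
    (fun x y ↦ X x ∧ X y ∧ G.TriangleEdge x y) (fun x y ↦ X x ∧ X y ∧ G.PendantEdge x y)
    (fun x y h ↦ ⟨h.2.1, h.1, h.2.2.symm⟩) (fun x y h ↦ ⟨h.2.1, h.1, h.2.2.symm⟩)
    (fun x h ↦ h.2.2.ne rfl) (fun x h ↦ h.2.2.1.ne rfl) (by
      -- A lone triangle loses its selected vertex. In a diamond, an uncolored inner vertex keeps at
      -- most one neighbor in `X`: the other inner vertex is colored and an end exposed, or both
      -- ends are exposed.
      rintro x y z ⟨hx, hy, hxy⟩ ⟨-, hz, hxz⟩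
      by_contra hne
      by_cases ho : G.IsOuter x
      · by_cases hl : G.IsLoneTriangleVertex x
        · obtain ⟨t, ht, htP⟩ := hS.exists_mem x hl
          obtain ⟨p, q, hpq, -, hN⟩ := hG.outer_structure ho
          have := hP t htP
          grind
        · have : ∃ b, G.TriangleEdge x b ∧ ¬ G.IsOuter b := by
            by_contra! h
            exact hl ⟨ho, h⟩
          obtain ⟨b, hxb, hb⟩ := this
          obtain ⟨c, d, hD⟩ := hG.exists_isDiamond_of_triangleEdge ho hxb hb
          have hbc : X b ∧ X c := by
            have := (hD.left_outer_iff _).1 hxy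
            have := (hD.left_outer_iff _).1 hxz
            grind
          have := hD.of_not_inPacking hG hF hbc.1.1
          have := hbc.2.1
          have := hx.2
          grind
      · obtain ⟨c, a, d, hD⟩ := hG.exists_isDiamond ho
        have h1 := hD.of_not_inPacking hG hF hx.1
        have := (hD.left_inner_iff _).1 hxy
        have := (hD.left_inner_iff _).1 hxz
        grind)
    (fun x y z h h' ↦ hG.pendantEdge_unique h.2.2 h'.2.2)
  -- The pendant neighbor of `u` is selected, hence colored. Two neighbors in `X` would be both
  -- inner vertices; then both colors are seen and `u` itself is colored.
  have hunique : ∀ u, (∀ k, ¬ G.InPacking P κ F k u) → G.IsExposedEnd P u → ∀ v w, X v → X w →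
      G.Adj u v → G.Adj u w → v = w := by
    rintro u hu ⟨⟨b, hub, hb⟩, s, hus, hs⟩ v w hv hw huv huw
    by_contra hne
    obtain ⟨c, d, hD⟩ := hG.exists_isDiamond_of_triangleEdge hus.isOuter_left hub hb
    have hXs : ∀ t, X t → ¬ G.PendantEdge u t := fun t ht h ↦
      hP t (hG.pendantEdge_unique hus h ▸ hs) ht.1
    have hbc : X b ∧ X c := by
      have h1 := hD.adj_end huv
      have h2 := hD.adj_end huw
      grind
    rcases hD.of_not_inPacking hG hF hbc.1.1 with ⟨⟨k, hk⟩, -⟩ | ⟨-, -, ht, hf⟩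
    · exact hbc.2.1 k hk
    · exact hu (!κ s) (.inr (.inr ⟨⟨s, hus, hs, by simp⟩, b, hub, hb, ht, hf⟩))
  have hexp : ∀ u v, (∀ k, ¬ G.InPacking P κ F k v) → G.IsExposedEnd P u → G.IsExposedEnd P v →
      ¬ G.Adj u v := by
    rintro u v hv ⟨⟨b, hub, hb⟩, s, hus, hs⟩ ⟨-, t, hvt, -⟩ h
    obtain ⟨c, d, hD⟩ := hG.exists_isDiamond_of_triangleEdge hus.isOuter_left hub hb
    rcases hD.adj_end h with rfl | rfl | h
    · exact hb hvt.isOuter_left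
    · exact hD.right_inner hvt.isOuter_left
    · exact hP v (hG.pendantEdge_unique hus h ▸ hs) hv
  let g' : V → Bool := fun v ↦
    if G.IsExposedEnd P v then decide (∃ w, X w ∧ G.Adj v w ∧ g w = false) else g v
  have hg' : ∀ u v, (∀ k, ¬ G.InPacking P κ F k u) → (∀ k, ¬ G.InPacking P κ F k v) →
      G.Adj u v → G.IsExposedEnd P u → ¬ G.IsExposedEnd P v → g' u ≠ g' v := by
    intro u v hu hv h hu' hv'
    simp only [g', hu', hv', if_true, if_false]
    have : (∃ w, X w ∧ G.Adj u w ∧ g w = false) ↔ g v = false := by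
      constructor
      · rintro ⟨w, hw, huw, hgw⟩
        rwa [hunique u hu hu' v w ⟨hv, hv'⟩ hw h huw]
      · exact fun hgv ↦ ⟨v, ⟨hv, hv'⟩, h, hgv⟩
    simp only [this]
    cases g v <;> simp
  refine ⟨g', fun u v hu hv h ↦ ?_⟩
  by_cases hu' : G.IsExposedEnd P u <;> by_cases hv' : G.IsExposedEnd P v
  · exact absurd h (hexp u v hv hu' hv')
  · exact hg' u v hu hv h hu' hv'
  · exact (hg' v u hv hu h.symm hv' hu').symm
  · simp only [g', hu', hv', if_false]
    refine hg u v ?_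
    rcases adj_iff_triangleEdge_or_pendantEdge.1 h with h | h
    exacts [.inl ⟨⟨hu, hu'⟩, ⟨hv, hv'⟩, h⟩, .inr ⟨⟨hu, hu'⟩, ⟨hv, hv'⟩, h⟩]

lemma IsLocallyPath.packingColorable [Finite V] (hG : G.IsLocallyPath) (hc : G.Connected) :
    G.PackingColorable ![1, 1, 2, 2] := by
  classical
  obtain ⟨P, κ, h1, h2, h3, h4, h5⟩ := hG.exists_selection hc
  have hS : G.IsSelection P κ := ⟨h1, h2, h3, h4, h5⟩
  obtain ⟨n, ⟨e⟩⟩ := Finite.exists_equiv_fin V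
  -- `F` holds at the inner vertex with the smaller label.
  obtain ⟨F, hF⟩ : ∃ F : V → Prop, ∀ b c a d, G.IsDiamond b c a d → (F b ↔ ¬ F c) := by
    have key : ∀ b c a d, G.IsDiamond b c a d →
        ((∀ x, G.TriangleEdge b x → ¬ G.IsOuter x → e b < e x) ↔ e b < e c) := by
      refine fun b c a d hD ↦
        ⟨fun h ↦ h c ((hD.left_inner_iff c).2 (.inl rfl)) hD.right_inner, fun h x hx hx' ↦ ?_⟩
      rcases (hD.left_inner_iff x).1 hx with rfl | rfl | rfl
      · exact h
      · exact absurd hD.left_outer hx'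
      · exact absurd hD.right_outer hx'
    refine ⟨fun b ↦ ∀ x, G.TriangleEdge b x → ¬ G.IsOuter x → e b < e x, fun b c a d hD ↦ ?_⟩
    beta_reduce
    rw [key b c a d hD, key c b a d hD.swap_inner, not_lt]
    exact ⟨le_of_lt, fun h ↦ lt_of_le_of_ne h fun h ↦ hD.inner_ne (e.injective h)⟩
  obtain ⟨g, hg⟩ := hG.exists_two_coloring hS hF
  have hnear : ∀ k u v, G.InPacking P κ F k u → G.InPacking P κ F k v → u ≠ v →
      2 < G.edist u v := by
    intro k u v hu hv hne
    have h := fun h ↦ hne (hG.inPacking_eq_of_near hS hF hu hv h)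
    rw [two_lt_edist_iff]
    refine ⟨hne, fun h' ↦ h (.inl h'), Set.eq_empty_of_forall_notMem fun w hw ↦ ?_⟩
    exact h (.inr ⟨w, hw.1, hw.2⟩)
  have hadj : ∀ u v, u ≠ v → ¬ G.Adj u v → 1 < G.edist u v := by
    intro u v hne h
    rw [← not_le, edist_le_one_iff_adj_or_eq]
    tauto
  have hrest : ∀ v, ¬ G.InPacking P κ F true v → ¬ G.InPacking P κ F false v →
      ∀ k, ¬ G.InPacking P κ F k v := fun v h h' k ↦ by cases k <;> assumption
  refine ⟨fun v ↦ if G.InPacking P κ F true v then 2 else if G.InPacking P κ F false v then 3 else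
    if g v then 0 else 1, fun i u v hne hu hv ↦ ?_⟩
  dsimp only at hu hv
  split_ifs at hu hv <;> subst hu <;> first
    | exact hnear true u v ‹_› ‹_› hne
    | exact hnear false u v ‹_› ‹_› hne
    | exact hadj u v hne fun h ↦ hg u v (hrest u ‹_› ‹_›) (hrest v ‹_› ‹_›) h (by simp_all)
    | exact absurd hv (by decide)

end SimpleGraph

namespace SimpleGraph

/-! ### From claw-free cubic graphs to the local condition. -/

variable {V : Type*} {G : SimpleGraph V}

lemma IsClawFree.exists_adj (hG : G.IsClawFree) {v x y z : V} (hx : G.Adj v x) (hy : G.Adj v y)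
    (hz : G.Adj v z) (hxy : x ≠ y) (hxz : x ≠ z) (hyz : y ≠ z) :
    G.Adj x y ∨ G.Adj x z ∨ G.Adj y z := by
  by_contra! h
  obtain ⟨h1, h2, h3⟩ := h
  have h1' : ¬ G.Adj y x := fun h ↦ h1 h.symm
  have h2' : ¬ G.Adj z x := fun h ↦ h2 h.symm
  have h3' : ¬ G.Adj z y := fun h ↦ h3 h.symm
  have hinj : Function.Injective (Sum.elim (fun _ : Fin 1 ↦ v) ![x, y, z]) := by
    rintro (i | i) (j | j) h
    · rw [Subsingleton.elim i j]
    · fin_cases j <;> simp [hx.ne, hy.ne, hz.ne] at h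
    · fin_cases i <;> simp [hx.ne', hy.ne', hz.ne'] at h
    · fin_cases i <;> fin_cases j <;> simp_all
  have hadj : ∀ i j, G.Adj (Sum.elim (fun _ : Fin 1 ↦ v) ![x, y, z] i)
      (Sum.elim (fun _ : Fin 1 ↦ v) ![x, y, z] j) ↔
      (completeBipartiteGraph (Fin 1) (Fin 3)).Adj i j := by
    rintro (i | i) (j | j)
    · simp
    · fin_cases j <;> simp [hx, hy, hz]
    · fin_cases i <;> simp [hx.symm, hy.symm, hz.symm]
    · fin_cases i <;> fin_cases j <;> simp [h1, h2, h3, h1', h2', h3']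
  exact hG ⟨⟨⟨_, hinj⟩, hadj _ _⟩⟩

/-- An injective coloring is a packing coloring. -/
lemma PackingColorable.of_card_le [Finite V] {r : ℕ} (S : Fin r → ℕ) (h : Nat.card V ≤ r) :
    G.PackingColorable S := by
  refine ⟨fun v ↦ Fin.castLE h (Finite.equivFin V v), fun i u v hne hu hv ↦ absurd ?_ hne⟩
  exact (Finite.equivFin V).injective (Fin.castLE_injective h (hu.trans hv.symm))

lemma Connected.mem_of_adj_closed (hG : G.Connected) {s : Set V} {v : V} (hv : v ∈ s)
    (h : ∀ x ∈ s, ∀ y, G.Adj x y → y ∈ s) (w : V) : w ∈ s := by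
  obtain ⟨p⟩ := hG v w
  induction p with
  | nil => exact hv
  | cons huv _ ih => exact ih (h _ hv _ huv)

/-- A connected claw-free cubic graph with more than four vertices has no vertex whose neighborhood
is a triangle. -/
lemma IsClawFree.isLocallyPath [Fintype V] [DecidableRel G.Adj] (hclaw : G.IsClawFree)
    (hc : G.Connected) (hcubic : G.IsRegularOfDegree 3) (hcard : ¬ Nat.card V ≤ 4) :
    G.IsLocallyPath := by
  classical
  have hN : ∀ v, ∃ x y z, x ≠ y ∧ x ≠ z ∧ y ≠ z ∧ ∀ w, G.Adj v w ↔ w = x ∨ w = y ∨ w = z := by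
    intro v
    obtain ⟨x, y, z, hxy, hxz, hyz, h⟩ := Finset.card_eq_three.1 (hcubic v)
    refine ⟨x, y, z, hxy, hxz, hyz, fun w ↦ ?_⟩
    rw [← mem_neighborFinset, h]
    simp
  have hmem : ∀ v a b c d, G.Adj v a → G.Adj v b → G.Adj v c → a ≠ b → a ≠ c → b ≠ c →
      G.Adj v d → d = a ∨ d = b ∨ d = c := by
    intro v a b c d
    obtain ⟨x, y, z, hxy, hxz, hyz, h⟩ := hN v
    grind
  intro v
  obtain ⟨x, y, z, hxy, hxz, hyz, h⟩ := hN v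
  have hx := (h x).2 (by simp)
  have hy := (h y).2 (by simp)
  have hz := (h z).2 (by simp)
  -- Otherwise `v, x, y, z` already have all their neighbors among themselves, so by connectedness
  -- they are the whole graph.
  have hK : ¬ (G.Adj x y ∧ G.Adj x z ∧ G.Adj y z) := by
    rintro ⟨h1, h2, h3⟩
    refine hcard ?_
    have hs : ∀ w, w ∈ ({v, x, y, z} : Set V) := by
      refine hc.mem_of_adj_closed (v := v) (by simp) fun s hs t hst ↦ ?_
      simp only [Set.mem_insert_iff, Set.mem_singleton_iff] at hs ⊢
      rcases hs with rfl | rfl | rfl | rfl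
      · exact .inr ((h t).1 hst)
      · have := hmem _ _ _ _ t hx.symm h1 h2 hy.ne hz.ne hyz hst; tauto
      · have := hmem _ _ _ _ t hy.symm h1.symm h3 hx.ne hz.ne hxz hst; tauto
      · have := hmem _ _ _ _ t hz.symm h2.symm h3.symm hx.ne hy.ne hxy hst; tauto
    have hu : (Finset.univ : Finset V) ⊆ {v, x, y, z} := fun w _ ↦ by simpa using hs w
    rw [Nat.card_eq_fintype_card]
    exact (Finset.card_le_card hu).trans Finset.card_le_four
  have hE := hclaw.exists_adj hx hy hz hxy hxz hyz
  by_cases h1 : G.Adj x y <;> by_cases h2 : G.Adj x z <;> by_cases h3 : G.Adj y z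
  · exact absurd ⟨h1, h2, h3⟩ hK
  · exact ⟨x, y, z, hxy, hxz, hyz, h, h1, h3⟩
  · exact ⟨y, x, z, hxy.symm, hyz, hxz, fun w ↦ by rw [h]; tauto, h1.symm, h2⟩
  · exact ⟨x, y, z, hxy, hxz, hyz, h, h1, h3⟩
  · exact ⟨z, x, y, hxz.symm, hyz.symm, hxy, fun w ↦ by rw [h]; tauto, h2.symm, h1⟩
  · exact ⟨x, z, y, hxz, hxy, hyz.symm, fun w ↦ by rw [h]; tauto, h2, fun h ↦ h3 h.symm⟩
  · exact ⟨y, z, x, hyz, hxy.symm, hxz.symm, fun w ↦ by rw [h]; tauto, h3, fun h ↦ h2 h.symm⟩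
  · tauto

end SimpleGraph

theorem mainTheorem2 {V : Type*} [Fintype V] (G : SimpleGraph V) [DecidableRel G.Adj]
    (hconn : G.IsEdgeConnected 2) (hclaw : G.IsClawFree) (hcubic : G.IsRegularOfDegree 3) :
    G.PackingColorable ![1, 1, 2, 2] := by
  by_cases hcard : Nat.card V ≤ 4
  · exact .of_card_le _ hcard
  · have : Nonempty V := (Nat.card_pos_iff.1 (by omega)).1
    have hc := hconn.connected two_ne_zero
    exact (hclaw.isLocallyPath hc hcubic hcard).packingColorable hc
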